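/- Let $\eta>0$ and let $C$ be a contour (a piecewise continuously differentiable curve) in $\mathbb{C}$ from $A$ to $B$. Let $\Theta$ be the branch of the function defined by $$e^{i\Theta(z)}=-\frac{\sinh(iz+\eta)}{\sinh(iz-\eta)},\qquad \Theta(0)=0,$$ where the branch is assumed to be single-valued and holomorphic on an open set containing all differences $\alpha-\beta$ with $\alpha,\beta\in C$ (for instance the strip $|\operatorname{Im} z|<\eta$), and let $K=\Theta'$. Let $D_-$ and $D_+$ be continuous functions on $C$ satisfying, for all $\alpha\in C$, $$D_-(\alpha)+\frac1{2\pi}\int_C K(\alpha-\beta)\,D_-(\beta)\,d\beta=\frac1{2\pi},$$ $$D_+(\alpha)+\frac1{2\pi}\int_C K(\alpha-\beta)\,D_+(\beta)\,d\beta=\frac1{2\pi}\bigl(\Theta(\alpha-B)+\Theta(\alpha-A)\bigr).$$ Then $$(1+D_+(B))\,D_-(B)=\frac1{2\pi},$$ whatever the endpoints $A$ and $B$ are. In particular this holds for $A=-a+ib$, $B=a+ib$ with $a\ge 0$ and $b\in\mathbb{R}$. -/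

import Mathlib

open Complex Set

/-- `γ`, restricted to `[0, 1]`, is a contour from `A` to `B`: a continuous curve which is continuously
differentiable, with bounded derivative, away from finitely many parameters. It may be a curve of any
shape; in particular it need not be simple. -/
structure IsContour (A B : ℂ) (γ : ℝ → ℂ) : Prop where
  source : γ 0 = A
  target : γ 1 = B
  continuousOn : ContinuousOn γ (Icc 0 1)
  piecewise_C1 : ∃ (S : Finset ℝ) (M : ℝ), ∀ t ∈ Ioo (0 : ℝ) 1, t ∉ S →
    DifferentiableAt ℝ γ t ∧ ContinuousAt (deriv γ) t ∧ ‖deriv γ t‖ ≤ M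

/-- The set of points of the contour. -/
def contourSet (γ : ℝ → ℂ) : Set ℂ := γ '' Icc 0 1

/-- The contour integral `∫_C f(β) dβ`. -/
noncomputable def contourIntegral (γ : ℝ → ℂ) (f : ℂ → ℂ) : ℂ :=
  ∫ t in (0 : ℝ)..1, f (γ t) * deriv γ t

/-- `Θ` is, on the open set `U`, a holomorphic branch of the function determined by
`e^{iΘ(z)} = - sinh(iz + η) / sinh(iz - η)`, normalized by `Θ(0) = 0` (the value forced by the oddness
of `Θ`). At a zero of the numerator or of the denominator the right-hand side is `0` in Lean, so `exp_eq`
excludes these points from `U`. -/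
structure IsThetaBranch (η : ℝ) (U : Set ℂ) (Θ : ℂ → ℂ) : Prop where
  isOpen : IsOpen U
  differentiableOn : DifferentiableOn ℂ Θ U
  map_zero : Θ 0 = 0
  exp_eq : ∀ z ∈ U, exp (I * Θ z) = -(sinh (I * z + η) / sinh (I * z - η))

/-- The kernel `K = Θ'`. -/
noncomputable def kernelK (Θ : ℂ → ℂ) : ℂ → ℂ := deriv Θ

/-- `((I + K / 2π) * D)(α) = D(α) + (1 / 2π) ∫_C K(α - β) D(β) dβ`. -/
noncomputable def onePlusK (Θ : ℂ → ℂ) (γ : ℝ → ℂ) (D : ℂ → ℂ) (α : ℂ) : ℂ :=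
  D α + 1 / (2 * Real.pi) * contourIntegral γ (fun β => kernelK Θ (α - β) * D β)

/-- `D` is a (continuous) solution on the contour of `(I + K / 2π) * D = 1 / 2π`. -/
def IsDMinus (Θ : ℂ → ℂ) (γ : ℝ → ℂ) (D : ℂ → ℂ) : Prop :=
  ContinuousOn D (contourSet γ) ∧
    ∀ α ∈ contourSet γ, onePlusK Θ γ D α = 1 / (2 * Real.pi)

/-- `D` is a (continuous) solution on the contour of
`(I + K / 2π) * D (α) = (1 / 2π) (Θ(α - B) + Θ(α - A))`, where `A`, `B` are the endpoints. -/
def IsDPlus (Θ : ℂ → ℂ) (A B : ℂ) (γ : ℝ → ℂ) (D : ℂ → ℂ) : Prop :=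
  ContinuousOn D (contourSet γ) ∧
    ∀ α ∈ contourSet γ, onePlusK Θ γ D α = 1 / (2 * Real.pi) * (Θ (α - B) + Θ (α - A))

/-- The branch of `Θ` on the strip `|Im z| < η` exists, and has a closed form. -/
theorem isThetaBranch_strip (η : ℝ) :
    IsThetaBranch η {z | |z.im| < η} (fun z => 2 * z - I *
      (log (1 - exp (-2 * η - 2 * I * z)) - log (1 - exp (-2 * η + 2 * I * z)))) := by
  have h1 : ∀ z : ℂ, |z.im| < η → ‖exp (-2 * η - 2 * I * z)‖ < 1 := by
    intro z hz
    rw [norm_exp, Real.exp_lt_one_iff]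
    have := abs_lt.1 hz
    simp
    linarith
  have h2 : ∀ z : ℂ, |z.im| < η → ‖exp (-2 * η + 2 * I * z)‖ < 1 := by
    intro z hz
    rw [norm_exp, Real.exp_lt_one_iff]
    have := abs_lt.1 hz
    simp
    linarith
  have h3 : ∀ w : ℂ, ‖w‖ < 1 → 1 - w ∈ slitPlane := by
    intro w hw
    have := mem_slitPlane_of_norm_lt_one (z := -w) (by simpa using hw)
    simpa [sub_eq_add_neg] using this
  refine ⟨isOpen_lt (continuous_abs.comp continuous_im) continuous_const, ?_, by simp, ?_⟩
  · intro z hz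
    have a1 := h3 _ (h1 z hz)
    have a2 := h3 _ (h2 z hz)
    apply DifferentiableAt.differentiableWithinAt
    have d1 : DifferentiableAt ℂ (fun z : ℂ => 1 - exp (-2 * η - 2 * I * z)) z := by fun_prop
    have d2 : DifferentiableAt ℂ (fun z : ℂ => 1 - exp (-2 * η + 2 * I * z)) z := by fun_prop
    exact ((differentiableAt_id.const_mul 2).sub
      (((d1.clog a1).sub (d2.clog a2)).const_mul I))
  · intro z hz
    have a1 := slitPlane_ne_zero (h3 _ (h1 z hz))
    have a2 := slitPlane_ne_zero (h3 _ (h2 z hz))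
    have e : I * (2 * z - I * (log (1 - exp (-2 * η - 2 * I * z)) -
        log (1 - exp (-2 * η + 2 * I * z)))) = 2 * (I * z) +
        log (1 - exp (-2 * η - 2 * I * z)) - log (1 - exp (-2 * η + 2 * I * z)) := by
      linear_combination (-(log (1 - exp (-2 * η - 2 * I * z)) -
        log (1 - exp (-2 * η + 2 * I * z)))) * I_sq
    rw [e, exp_sub, exp_add, exp_log a1, exp_log a2]
    have b1 : 2 * sinh (I * z + η) = exp (I * z + η) * (1 - exp (-2 * η - 2 * I * z)) := by
      rw [two_sinh, mul_sub, ← exp_add, mul_one]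
      congr 2
      ring
    have b2 : 2 * sinh (I * z - η) = -(exp (-(I * z) + η) * (1 - exp (-2 * η + 2 * I * z))) := by
      rw [two_sinh, mul_sub, ← exp_add, mul_one]
      ring_nf
    have b3 : sinh (I * z + η) / sinh (I * z - η) =
        (2 * sinh (I * z + η)) / (2 * sinh (I * z - η)) := by
      rw [mul_div_mul_left _ _ two_ne_zero]
    rw [b3, b1, b2]
    have b4 : exp (I * z + η) = exp (2 * (I * z)) * exp (-(I * z) + η) := by
      rw [← exp_add]
      congr 1
      ring
    rw [b4]
    have := exp_ne_zero (-(I * z) + η)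
    field_simp

/-!
The equations for `D₋` and `D₊` have the form `D(α) + (1/2π) ∫_C K(α - β) D(β) dβ = f(α)`, and each of
them extends its solution holomorphically to a neighbourhood of the contour. For two such solutions,
integrate `(D₁ D₂)'` along `C`. The kernel `K = Θ'` is even, so `K'` is odd, and the double integrals
containing `K'` cancel after the two variables are exchanged. What remains is
`D₁(B) D₂(B) - D₁(A) D₂(A) = ∫_C f₁' D₂ + ∫_C f₂' D₁` (`IsContour.mul_sub_mul_eq_integral`).

The derivative of the datum `1/2π` is `0`, and that of the datum of `D₊` is
`(K(α - B) + K(α - A)) / 2π`, whose integral against a solution is known from the integral equation of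
that solution at the endpoints. The three choices of the pair `(D₁, D₂)` then give
* `D₋(B)² = D₋(A)²`,
* `(1 + D₊(B)) D₋(B) + (1 - D₊(A)) D₋(A) = 1/π`,
* `(1 + D₊(B))² = (1 - D₊(A))²`, where `Θ(B - A) = -Θ(A - B)` is used.

So the two summands in the second identity have equal squares and a nonzero sum. Hence they are equal,
and each is `1/2π`. Neither invertibility of the integral operator nor a symmetry of `C` is needed.
-/

open Filter Topology MeasureTheory

/-! ### Contour integrals -/

theorem IsContour.isCompact {A B : ℂ} {γ : ℝ → ℂ} (hγ : IsContour A B γ) :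
    IsCompact (contourSet γ) :=
  isCompact_Icc.image_of_continuousOn hγ.continuousOn

theorem mapsTo_contourSet {γ : ℝ → ℂ} : MapsTo γ (Icc 0 1) (contourSet γ) :=
  mapsTo_image _ _

theorem IsContour.source_mem {A B : ℂ} {γ : ℝ → ℂ} (hγ : IsContour A B γ) :
    A ∈ contourSet γ := ⟨0, by simp, hγ.source⟩

theorem IsContour.target_mem {A B : ℂ} {γ : ℝ → ℂ} (hγ : IsContour A B γ) :
    B ∈ contourSet γ := ⟨1, by simp, hγ.target⟩

theorem IsContour.integrableOn_deriv {A B : ℂ} {γ : ℝ → ℂ} (hγ : IsContour A B γ) :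
    IntegrableOn (deriv γ) (Ioc 0 1) := by
  obtain ⟨S, M, hM⟩ := hγ.piecewise_C1
  refine Measure.integrableOn_of_bounded (M := M) (by simp)
    (measurable_deriv γ).aestronglyMeasurable ?_
  have hnull : ∀ᵐ t : ℝ, t ∉ insert (1 : ℝ) (S : Set ℝ) :=
    ((S.countable_toSet).insert 1).ae_notMem _
  filter_upwards [ae_restrict_of_ae hnull, ae_restrict_mem measurableSet_Ioc] with t ht ht'
  simp only [mem_insert_iff, not_or] at ht
  exact (hM t ⟨ht'.1, lt_of_le_of_ne ht'.2 ht.1⟩ (by simpa using ht.2)).2.2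

theorem IsContour.integrable {A B : ℂ} {γ : ℝ → ℂ} (hγ : IsContour A B γ) {F : ℂ → ℂ}
    (hF : ContinuousOn F (contourSet γ)) :
    IntervalIntegrable (fun t => F (γ t) * deriv γ t) volume 0 1 := by
  rw [intervalIntegrable_iff_integrableOn_Ioc_of_le zero_le_one]
  obtain ⟨c, hc⟩ := hγ.isCompact.exists_bound_of_continuousOn hF
  refine Integrable.bdd_mul (c := c) hγ.integrableOn_deriv ?_ ?_
  · exact ((hF.comp hγ.continuousOn mapsTo_contourSet).mono
      Ioc_subset_Icc_self).aestronglyMeasurable measurableSet_Ioc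
  · filter_upwards [ae_restrict_mem measurableSet_Ioc] with t ht
    exact hc _ (mapsTo_contourSet (Ioc_subset_Icc_self ht))

/-- Integrands need only agree on the contour. -/
theorem contourIntegral_congr {γ : ℝ → ℂ} {F G : ℂ → ℂ} (h : EqOn F G (contourSet γ)) :
    contourIntegral γ F = contourIntegral γ G := by
  refine intervalIntegral.integral_congr fun t ht => ?_
  rw [uIcc_of_le zero_le_one] at ht
  simp only [h (mapsTo_contourSet ht)]

theorem IsContour.integral_add {A B : ℂ} {γ : ℝ → ℂ} (hγ : IsContour A B γ) {F G : ℂ → ℂ}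
    (hF : ContinuousOn F (contourSet γ)) (hG : ContinuousOn G (contourSet γ)) :
    contourIntegral γ (fun z => F z + G z) = contourIntegral γ F + contourIntegral γ G := by
  simp only [contourIntegral, add_mul]
  exact intervalIntegral.integral_add (hγ.integrable hF) (hγ.integrable hG)

theorem contourIntegral_const_mul (γ : ℝ → ℂ) (c : ℂ) (F : ℂ → ℂ) :
    contourIntegral γ (fun z => c * F z) = c * contourIntegral γ F := by
  simp only [contourIntegral, mul_assoc]
  exact intervalIntegral.integral_const_mul c _

/-- The fundamental theorem of calculus along a contour. -/
theorem IsContour.integral_eq_sub {A B : ℂ} {γ : ℝ → ℂ} (hγ : IsContour A B γ) {E e : ℂ → ℂ}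
    (hE : ∀ z ∈ contourSet γ, HasDerivAt E (e z) z) (he : ContinuousOn e (contourSet γ)) :
    contourIntegral γ e = E B - E A := by
  obtain ⟨S, M, hM⟩ := hγ.piecewise_C1
  have hEc : ContinuousOn E (contourSet γ) := fun z hz => (hE z hz).continuousAt.continuousWithinAt
  have := integral_eq_of_hasDerivAt_off_countable_of_le (fun t => E (γ t))
    (fun t => e (γ t) * deriv γ t) (zero_le_one (α := ℝ)) S.countable_toSet
    (hEc.comp hγ.continuousOn mapsTo_contourSet)
    (fun t ht => (hE _ (mapsTo_contourSet (Ioo_subset_Icc_self ht.1))).comp_of_eq t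
      (hM t ht.1 (by simpa using ht.2)).1.hasDerivAt rfl) (hγ.integrable he)
  rw [hγ.source, hγ.target] at this
  exact this

/-- Fubini's theorem for contour integrals. -/
theorem IsContour.integral_swap {A B : ℂ} {γ : ℝ → ℂ} (hγ : IsContour A B γ) {F : ℂ → ℂ → ℂ}
    (hF : ContinuousOn (fun p : ℂ × ℂ => F p.1 p.2) (contourSet γ ×ˢ contourSet γ)) :
    contourIntegral γ (fun α => contourIntegral γ (fun β => F α β)) =
      contourIntegral γ (fun β => contourIntegral γ (fun α => F α β)) := by
  obtain ⟨c, hc⟩ := (hγ.isCompact.prod hγ.isCompact).exists_bound_of_continuousOn hF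
  have hm : Ioc (0 : ℝ) 1 ×ˢ Ioc (0 : ℝ) 1 ⊆ Icc 0 1 ×ˢ Icc 0 1 :=
    prod_mono Ioc_subset_Icc_self Ioc_subset_Icc_self
  have hmaps : MapsTo (fun p : ℝ × ℝ => (γ p.1, γ p.2)) (Icc 0 1 ×ˢ Icc 0 1)
      (contourSet γ ×ˢ contourSet γ) :=
    fun p hp => ⟨mapsTo_contourSet hp.1, mapsTo_contourSet hp.2⟩
  have hcont : ContinuousOn (fun p : ℝ × ℝ => F (γ p.1) (γ p.2)) (Icc 0 1 ×ˢ Icc 0 1) :=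
    hF.comp ((hγ.continuousOn.comp continuousOn_fst fun p hp => hp.1).prodMk
      (hγ.continuousOn.comp continuousOn_snd fun p hp => hp.2)) hmaps
  have hint : Integrable (fun p : ℝ × ℝ => F (γ p.1) (γ p.2) * (deriv γ p.1 * deriv γ p.2))
      ((volume.restrict (Ioc (0 : ℝ) 1)).prod (volume.restrict (Ioc (0 : ℝ) 1))) := by
    refine Integrable.bdd_mul (c := c)
      (Integrable.mul_prod hγ.integrableOn_deriv hγ.integrableOn_deriv) ?_ ?_
    · rw [Measure.prod_restrict]
      exact (hcont.mono hm).aestronglyMeasurable (measurableSet_Ioc.prod measurableSet_Ioc)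
    · rw [Measure.prod_restrict]
      filter_upwards [ae_restrict_mem (measurableSet_Ioc.prod measurableSet_Ioc)] with p hp
      exact hc _ (hmaps (hm hp))
  have := integral_integral_swap
    (f := fun s t : ℝ => F (γ s) (γ t) * (deriv γ s * deriv γ t)) hint
  simp only [contourIntegral, intervalIntegral.integral_of_le zero_le_one,
    ← integral_mul_const]
  refine Eq.trans ?_ (this.trans ?_) <;>
  · refine integral_congr_ae (ae_of_all _ fun s => integral_congr_ae (ae_of_all _ fun t => ?_))
    ring

/-- Differentiation under the integral sign for a convolution along the contour. -/
theorem IsContour.hasDerivAt_convolution {A B : ℂ} {γ : ℝ → ℂ} (hγ : IsContour A B γ)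
    {U : Set ℂ} (hUo : IsOpen U) {K D : ℂ → ℂ} (hK : DifferentiableOn ℂ K U)
    (hD : ContinuousOn D (contourSet γ)) {z : ℂ} (hz : ∀ β ∈ contourSet γ, z - β ∈ U) :
    HasDerivAt (fun w => contourIntegral γ (fun β => K (w - β) * D β))
      (contourIntegral γ (fun β => deriv K (z - β) * D β)) z := by
  have hK' : ContinuousOn (deriv K) U := (hK.deriv hUo).continuousOn
  obtain ⟨δ, hδ, hδU⟩ := (hγ.isCompact.image_of_continuousOn
    (f := fun β => z - β) (by fun_prop)).exists_cthickening_subset_open hUo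
    (by rintro _ ⟨β, hβ, rfl⟩; exact hz β hβ)
  have hcomp : IsCompact (Metric.cthickening δ ((fun β => z - β) '' contourSet γ)) :=
    (hγ.isCompact.image_of_continuousOn (f := fun β => z - β) (by fun_prop)).cthickening
  obtain ⟨c, hc⟩ := hcomp.exists_bound_of_continuousOn (hK'.mono hδU)
  -- The shifts of the contour by points of this ball stay in a compact subset of `U`.
  have hball : ∀ w ∈ Metric.ball z δ, ∀ β ∈ contourSet γ,
      w - β ∈ Metric.cthickening δ ((fun β => z - β) '' contourSet γ) := by
    intro w hw β hβ
    refine Metric.mem_cthickening_of_dist_le _ (z - β) _ _ ⟨β, hβ, rfl⟩ ?_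
    rw [dist_sub_right]
    exact (Metric.mem_ball.1 hw).le
  have hmem : ∀ t ∈ uIoc (0 : ℝ) 1, γ t ∈ contourSet γ := fun t ht =>
    mapsTo_contourSet (Ioc_subset_Icc_self (by rwa [uIoc_of_le zero_le_one] at ht))
  have hshift : ∀ L : ℂ → ℂ, ContinuousOn L U → ∀ w ∈ Metric.ball z δ,
      IntervalIntegrable (fun t => L (w - γ t) * D (γ t) * deriv γ t) volume 0 1 :=
    fun L hL w hw => hγ.integrable (F := fun β => L (w - β) * D β)
      ((hL.comp (by fun_prop) fun β hβ => hδU (hball w hw β hβ)).mul hD)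
  have hzb : z ∈ Metric.ball z δ := Metric.mem_ball_self hδ
  refine (intervalIntegral.hasDerivAt_integral_of_dominated_loc_of_deriv_le
    (F := fun w t => K (w - γ t) * D (γ t) * deriv γ t)
    (F' := fun w t => deriv K (w - γ t) * D (γ t) * deriv γ t)
    (bound := fun t => c * ‖D (γ t) * deriv γ t‖) (Metric.ball_mem_nhds z hδ) ?_
    (hshift K hK.continuousOn z hzb) (hshift _ hK' z hzb).def'.aestronglyMeasurable ?_ ?_ ?_).2
  · filter_upwards [Metric.ball_mem_nhds z hδ] with w hw
    exact (hshift K hK.continuousOn w hw).def'.aestronglyMeasurable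
  · refine ae_of_all _ fun t ht w hw => ?_
    rw [mul_assoc, norm_mul]
    exact mul_le_mul_of_nonneg_right (hc _ (hball w hw _ (hmem t ht))) (norm_nonneg _)
  · exact (hγ.integrable hD).norm.const_mul c
  · refine ae_of_all _ fun t ht w hw => ?_
    have hw' : w - γ t ∈ U := hδU (hball w hw _ (hmem t ht))
    have h1 : HasDerivAt K (deriv K (w - γ t)) (w - γ t) :=
      (hK.differentiableAt (hUo.mem_nhds hw')).hasDerivAt
    exact ((h1.comp_sub_const w (γ t)).mul_const _).mul_const _

/-! ### The bilinear identity for two solutions -/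

/-- Let `D₁`, `D₂` solve `D + c ∫_C K(α - β) D(β) dβ = f(α)` on `C`, with data `f₁`, `f₂` having
derivatives `g₁`, `g₂`. If `K'` is odd, the terms in `K'` cancel when `D₁ D₂` is differentiated and
integrated along `C`, and only the derivatives of the data contribute. -/
theorem IsContour.mul_sub_mul_eq_integral {A B : ℂ} {γ : ℝ → ℂ} (hγ : IsContour A B γ)
    {U : Set ℂ} (hUo : IsOpen U) (hU : ∀ α ∈ contourSet γ, ∀ β ∈ contourSet γ, α - β ∈ U)
    {K : ℂ → ℂ} (hK : DifferentiableOn ℂ K U)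
    (hodd : ∀ α ∈ contourSet γ, ∀ β ∈ contourSet γ, deriv K (β - α) = -deriv K (α - β))
    (c : ℂ) {D₁ D₂ f₁ f₂ g₁ g₂ : ℂ → ℂ}
    (hD₁ : ContinuousOn D₁ (contourSet γ)) (hD₂ : ContinuousOn D₂ (contourSet γ))
    (hf₁ : ∀ z ∈ contourSet γ, HasDerivAt f₁ (g₁ z) z)
    (hf₂ : ∀ z ∈ contourSet γ, HasDerivAt f₂ (g₂ z) z)
    (hg₁ : ContinuousOn g₁ (contourSet γ)) (hg₂ : ContinuousOn g₂ (contourSet γ))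
    (h₁ : ∀ α ∈ contourSet γ,
      D₁ α + c * contourIntegral γ (fun β => K (α - β) * D₁ β) = f₁ α)
    (h₂ : ∀ α ∈ contourSet γ,
      D₂ α + c * contourIntegral γ (fun β => K (α - β) * D₂ β) = f₂ α) :
    D₁ B * D₂ B - D₁ A * D₂ A =
      contourIntegral γ (fun z => g₁ z * D₂ z) + contourIntegral γ (fun z => g₂ z * D₁ z) := by
  have hK' : DifferentiableOn ℂ (deriv K) U := hK.deriv hUo
  -- `G D` is the derivative of the convolution `K * D`.
  let G : (ℂ → ℂ) → ℂ → ℂ := fun D z => contourIntegral γ (fun β => deriv K (z - β) * D β)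
  have hG : ∀ D, ContinuousOn D (contourSet γ) → ContinuousOn (G D) (contourSet γ) :=
    fun D hD z hz => (hγ.hasDerivAt_convolution hUo hK' hD
      (hU z hz)).continuousAt.continuousWithinAt
  -- The integral equation extends `D₁`, `D₂` holomorphically to a neighbourhood of the contour.
  let E : (ℂ → ℂ) → (ℂ → ℂ) → ℂ → ℂ := fun f D z =>
    f z - c * contourIntegral γ (fun β => K (z - β) * D β)
  have hE : ∀ f g D : ℂ → ℂ, ContinuousOn D (contourSet γ) →
      (∀ z ∈ contourSet γ, HasDerivAt f (g z) z) →
      ∀ z ∈ contourSet γ, HasDerivAt (E f D) (g z - c * G D z) z :=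
    fun f g D hD hf z hz => (hf z hz).sub
      ((hγ.hasDerivAt_convolution hUo hK hD (hU z hz)).const_mul c)
  have hE₁ : EqOn (E f₁ D₁) D₁ (contourSet γ) := fun z hz => by
    simp only [E]; linear_combination -h₁ z hz
  have hE₂ : EqOn (E f₂ D₂) D₂ (contourSet γ) := fun z hz => by
    simp only [E]; linear_combination -h₂ z hz
  have hE₁c : ContinuousOn (E f₁ D₁) (contourSet γ) := hD₁.congr hE₁
  have hE₂c : ContinuousOn (E f₂ D₂) (contourSet γ) := hD₂.congr hE₂
  have hG₁ := hG D₁ hD₁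
  have hG₂ := hG D₂ hD₂
  have hFTC := hγ.integral_eq_sub (E := fun z => E f₁ D₁ z * E f₂ D₂ z)
    (fun z hz => (hE f₁ g₁ D₁ hD₁ hf₁ z hz).mul (hE f₂ g₂ D₂ hD₂ hf₂ z hz)) (by fun_prop)
  simp only [hE₁ hγ.source_mem, hE₁ hγ.target_mem, hE₂ hγ.source_mem, hE₂ hγ.target_mem] at hFTC
  have hsplit : contourIntegral γ (fun z => (g₁ z - c * G D₁ z) * E f₂ D₂ z +
      E f₁ D₁ z * (g₂ z - c * G D₂ z)) =
      contourIntegral γ (fun z => g₁ z * D₂ z) + contourIntegral γ (fun z => g₂ z * D₁ z) +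
      -c * (contourIntegral γ (fun z => G D₁ z * D₂ z) +
        contourIntegral γ (fun z => G D₂ z * D₁ z)) := by
    rw [← hγ.integral_add (by fun_prop) (by fun_prop),
      ← hγ.integral_add (by fun_prop) (by fun_prop), ← contourIntegral_const_mul,
      ← hγ.integral_add (by fun_prop) (by fun_prop)]
    refine contourIntegral_congr fun z hz => ?_
    simp only [hE₁ hz, hE₂ hz]
    ring
  -- Exchanging the names of the two variables changes the sign of `K'`.
  have hcancel : contourIntegral γ (fun z => G D₁ z * D₂ z) =
      -1 * contourIntegral γ (fun z => G D₂ z * D₁ z) := by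
    have hcont : ContinuousOn (fun p : ℂ × ℂ => deriv K (p.1 - p.2) * D₁ p.2 * D₂ p.1)
        (contourSet γ ×ˢ contourSet γ) :=
      ((hK'.continuousOn.comp (by fun_prop) fun p hp => hU _ hp.1 _ hp.2).mul
        (hD₁.comp continuousOn_snd fun p hp => hp.2)).mul
        (hD₂.comp continuousOn_fst fun p hp => hp.1)
    calc contourIntegral γ (fun z => G D₁ z * D₂ z)
        = contourIntegral γ (fun α => contourIntegral γ
            (fun β => deriv K (α - β) * D₁ β * D₂ α)) := by
          refine contourIntegral_congr fun α _ => ?_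
          simp only [G]
          rw [mul_comm, ← contourIntegral_const_mul]
          exact contourIntegral_congr fun β _ => mul_comm _ _
      _ = contourIntegral γ (fun β => contourIntegral γ
            (fun α => deriv K (α - β) * D₁ β * D₂ α)) :=
          hγ.integral_swap (F := fun α β => deriv K (α - β) * D₁ β * D₂ α) hcont
      _ = -1 * contourIntegral γ (fun z => G D₂ z * D₁ z) := by
          rw [← contourIntegral_const_mul]
          refine contourIntegral_congr fun β hβ => ?_
          simp only [G]
          rw [mul_comm _ (D₁ β), ← mul_assoc, ← contourIntegral_const_mul]
          refine contourIntegral_congr fun α hα => ?_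
          simp only [hodd β hβ α hα]
          ring
  rw [← hFTC, hsplit, hcancel]
  ring

/-! ### Parity of the phase and of the kernel -/

/-- Up to multiples of `2π`, `Θ` is odd. The right-hand side of `exp_eq` is nonzero on `U`, as it equals
an exponential, so neither quotient takes the junk value `0`. -/
theorem IsThetaBranch.exp_add_neg {η : ℝ} {U : Set ℂ} {Θ : ℂ → ℂ} (hΘ : IsThetaBranch η U Θ)
    {z : ℂ} (hz : z ∈ U) (hz' : -z ∈ U) : exp (I * (Θ z + Θ (-z))) = 1 := by
  have h1 := hΘ.exp_eq z hz
  have h2 := hΘ.exp_eq (-z) hz'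
  have e1 : sinh (I * -z + η) = -sinh (I * z - η) := by rw [← sinh_neg]; congr 1; ring
  have e2 : sinh (I * -z - η) = -sinh (I * z + η) := by rw [← sinh_neg]; congr 1; ring
  have hne := exp_ne_zero (I * Θ z)
  rw [h1, neg_ne_zero, div_ne_zero_iff] at hne
  obtain ⟨ha, hb⟩ := hne
  rw [mul_add, exp_add, h1, h2, e1, e2]
  field_simp

theorem IsThetaBranch.hasDerivAt {η : ℝ} {U : Set ℂ} {Θ : ℂ → ℂ} (hΘ : IsThetaBranch η U Θ)
    {z : ℂ} (hz : z ∈ U) : HasDerivAt Θ (kernelK Θ z) z :=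
  (hΘ.differentiableOn.differentiableAt (hΘ.isOpen.mem_nhds hz)).hasDerivAt

theorem IsThetaBranch.differentiableOn_kernelK {η : ℝ} {U : Set ℂ} {Θ : ℂ → ℂ}
    (hΘ : IsThetaBranch η U Θ) : DifferentiableOn ℂ (kernelK Θ) U :=
  hΘ.differentiableOn.deriv hΘ.isOpen

theorem IsThetaBranch.eventually_mem {η : ℝ} {U : Set ℂ} {Θ : ℂ → ℂ} (hΘ : IsThetaBranch η U Θ)
    {z : ℂ} (hz : z ∈ U) (hz' : -z ∈ U) : ∀ᶠ w in 𝓝 z, w ∈ U ∧ -w ∈ U :=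
  (hΘ.isOpen.eventually_mem hz).and
    (continuous_neg.continuousAt.eventually (hΘ.isOpen.eventually_mem hz'))

/-- The kernel is even: this is the logarithmic derivative of `exp_add_neg`. -/
theorem IsThetaBranch.kernelK_neg {η : ℝ} {U : Set ℂ} {Θ : ℂ → ℂ} (hΘ : IsThetaBranch η U Θ)
    {z : ℂ} (hz : z ∈ U) (hz' : -z ∈ U) : kernelK Θ (-z) = kernelK Θ z := by
  have hd : HasDerivAt (fun w => exp (I * (Θ w + Θ (-w))))
      (exp (I * (Θ z + Θ (-z))) * (I * (kernelK Θ z + kernelK Θ (-z) * -1))) z :=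
    (((hΘ.hasDerivAt hz).add ((hΘ.hasDerivAt hz').comp z (hasDerivAt_neg z))).const_mul I).cexp
  have hconst : (fun w => exp (I * (Θ w + Θ (-w)))) =ᶠ[𝓝 z] fun _ => 1 := by
    filter_upwards [hΘ.eventually_mem hz hz'] with w hw
    exact hΘ.exp_add_neg hw.1 hw.2
  have h0 := hd.unique ((hasDerivAt_const z (1 : ℂ)).congr_of_eventuallyEq hconst)
  have h1 := (mul_eq_zero.1 ((mul_eq_zero.1 h0).resolve_left (exp_ne_zero _))).resolve_left I_ne_zero
  linear_combination -h1

theorem IsThetaBranch.deriv_kernelK_neg {η : ℝ} {U : Set ℂ} {Θ : ℂ → ℂ}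
    (hΘ : IsThetaBranch η U Θ) {z : ℂ} (hz : z ∈ U) (hz' : -z ∈ U) :
    deriv (kernelK Θ) (-z) = -deriv (kernelK Θ) z := by
  have heq : (fun w => kernelK Θ (-w)) =ᶠ[𝓝 z] kernelK Θ := by
    filter_upwards [hΘ.eventually_mem hz hz'] with w hw
    exact hΘ.kernelK_neg hw.1 hw.2
  rw [← heq.deriv_eq, deriv_comp_neg, neg_neg]

/-- On the contour `Θ(α - A) + Θ(A - α)` is constant, because `K` is even; it vanishes at `α = A`. -/
theorem IsThetaBranch.theta_sub_endpoints {η : ℝ} {U : Set ℂ} {Θ : ℂ → ℂ}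
    (hΘ : IsThetaBranch η U Θ) {A B : ℂ} {γ : ℝ → ℂ} (hγ : IsContour A B γ)
    (hU : ∀ α ∈ contourSet γ, ∀ β ∈ contourSet γ, α - β ∈ U) :
    Θ (B - A) + Θ (A - B) = 0 := by
  have hd : ∀ z ∈ contourSet γ, HasDerivAt (fun w => Θ (w - A) + Θ (A - w)) 0 z := by
    intro z hz
    have h1 := (hΘ.hasDerivAt (hU z hz A hγ.source_mem)).comp_sub_const z A
    have h2 := (hΘ.hasDerivAt (hU A hγ.source_mem z hz)).comp_const_sub A z
    have h3 := hΘ.kernelK_neg (hU z hz A hγ.source_mem)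
      (by rw [neg_sub]; exact hU A hγ.source_mem z hz)
    rw [neg_sub] at h3
    rw [h3] at h2
    exact (h1.add h2).congr_deriv (add_neg_cancel _)
  have := hγ.integral_eq_sub hd continuousOn_const
  simpa [contourIntegral, hΘ.map_zero] using this.symm

/-! ### The identity at the endpoints -/

theorem mainTheorem3 (η : ℝ) (hη : 0 < η) (A B : ℂ) (γ : ℝ → ℂ) (hγ : IsContour A B γ)
    (U : Set ℂ) (Θ : ℂ → ℂ) (hΘ : IsThetaBranch η U Θ)
    (hU : ∀ α ∈ contourSet γ, ∀ β ∈ contourSet γ, α - β ∈ U)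
    (Dm Dp : ℂ → ℂ) (hDm : IsDMinus Θ γ Dm) (hDp : IsDPlus Θ A B γ Dp) :
    (1 + Dp B) * Dm B = 1 / (2 * Real.pi) := by
  obtain ⟨hmc, hm⟩ := hDm
  obtain ⟨hpc, hp⟩ := hDp
  have hA := hγ.source_mem
  have hB := hγ.target_mem
  set c : ℂ := 1 / (2 * Real.pi) with hc
  have hc0 : c ≠ 0 := by simp [hc, Real.pi_ne_zero]
  have hK := hΘ.differentiableOn_kernelK
  have hKc : ∀ e ∈ contourSet γ, ContinuousOn (fun z => kernelK Θ (z - e)) (contourSet γ) :=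
    fun e he => hK.continuousOn.comp (by fun_prop) fun z hz => hU z hz e he
  have hKA := hKc A hA
  have hKB := hKc B hB
  have hodd : ∀ α ∈ contourSet γ, ∀ β ∈ contourSet γ,
      deriv (kernelK Θ) (β - α) = -deriv (kernelK Θ) (α - β) := by
    intro α hα β hβ
    have h := hΘ.deriv_kernelK_neg (hU α hα β hβ) (by rw [neg_sub]; exact hU β hβ α hα)
    rwa [neg_sub] at h
  have hfm : ∀ z ∈ contourSet γ, HasDerivAt (fun _ : ℂ => c) ((fun _ => 0) z) z :=
    fun z _ => hasDerivAt_const z c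
  have hfp : ∀ z ∈ contourSet γ, HasDerivAt (fun z => c * (Θ (z - B) + Θ (z - A)))
      ((fun z => c * (kernelK Θ (z - B) + kernelK Θ (z - A))) z) z := fun z hz =>
    (((hΘ.hasDerivAt (hU z hz B hB)).comp_sub_const z B).add
      ((hΘ.hasDerivAt (hU z hz A hA)).comp_sub_const z A)).const_mul c
  have hgp : ContinuousOn (fun z => c * (kernelK Θ (z - B) + kernelK Θ (z - A)))
      (contourSet γ) := by fun_prop
  -- The derivative of the datum of `Dp` is paired with a solution `D` by means of the integral
  -- equations of `D` at the two endpoints.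
  have hpair : ∀ D : ℂ → ℂ, ContinuousOn D (contourSet γ) →
      contourIntegral γ (fun z => c * (kernelK Θ (z - B) + kernelK Θ (z - A)) * D z) =
        (onePlusK Θ γ D B - D B) + (onePlusK Θ γ D A - D A) := by
    intro D hD
    have heven : ∀ e ∈ contourSet γ, contourIntegral γ (fun z => kernelK Θ (z - e) * D z) =
        contourIntegral γ (fun z => kernelK Θ (e - z) * D z) := by
      refine fun e he => contourIntegral_congr fun z hz => ?_
      have h := hΘ.kernelK_neg (hU z hz e he) (by rw [neg_sub]; exact hU e he z hz)
      rw [neg_sub] at h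
      simp only [h]
    simp only [onePlusK, ← hc, mul_assoc, add_mul, contourIntegral_const_mul]
    rw [hγ.integral_add (by fun_prop) (by fun_prop), heven A hA, heven B hB]
    ring
  have hzero : ∀ D : ℂ → ℂ, contourIntegral γ (fun z => 0 * D z) = 0 := fun D => by
    simp [contourIntegral]
  have hmm := hγ.mul_sub_mul_eq_integral hΘ.isOpen hU hK hodd c hmc hmc hfm hfm
    continuousOn_const continuousOn_const hm hm
  have hmp := hγ.mul_sub_mul_eq_integral hΘ.isOpen hU hK hodd c hmc hpc hfm hfp
    continuousOn_const hgp hm hp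
  have hpp := hγ.mul_sub_mul_eq_integral hΘ.isOpen hU hK hodd c hpc hpc hfp hfp hgp hgp hp hp
  simp only [hzero, hpair Dm hmc, hpair Dp hpc, hm A hA, hm B hB, hp A hA, hp B hB,
    sub_self, hΘ.map_zero] at hmm hmp hpp
  have hθ := hΘ.theta_sub_endpoints hγ hU
  -- The quantities `x` and `y` attached to the endpoints have sum `2 c` and equal squares.
  set x := (1 + Dp B) * Dm B with hx
  set y := (1 - Dp A) * Dm A with hy
  have hsum : x + y = 2 * c := by
    rw [hx, hy]
    linear_combination hmp
  have hm2 : Dm B ^ 2 = Dm A ^ 2 := by linear_combination hmm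
  have hp2 : (1 + Dp B) ^ 2 = (1 - Dp A) ^ 2 := by
    linear_combination hpp + 2 * c * hθ
  have hsq : x ^ 2 = y ^ 2 := by rw [hx, hy, mul_pow, mul_pow, hm2, hp2]
  have hdiff : x - y = 0 := by
    refine (mul_eq_zero.1 (?_ : 2 * c * (x - y) = 0)).resolve_left
      (mul_ne_zero two_ne_zero hc0)
    rw [← hsum]
    linear_combination hsq
  linear_combination (hsum + hdiff) / 2
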